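/- Let $\mathbb{K}$ be an arbitrary field, $n\ge 0$ an integer and $A$ an $n\times n$ matrix with entries in $\mathbb{K}$; let $E_n$ be the $n\times n$ identity matrix. For $0\le i\le n$ let $d_i\in\mathbb{K}[x]$ be the monic greatest common divisor of all $i\times i$ minors of $xE_n-A$ (so $d_0=1$), for $1\le i\le n$ put $e_i=d_i/d_{i-1}$, and call $p_i(A)=e_{n-i+1}$ the $i$-th invariant polynomial of $A$ $(1\le i\le n)$. Let $k$ be the number of indices $i\in\{1,\dots,n\}$ such that $p_i(A)$ is not a product of pairwise distinct monic linear polynomials over $\mathbb{K}$ (the constant $1$ counts as the empty product). Let $(E_n;A)$ denote the $n\times n\times 2$ tensor over $\mathbb{K}$ whose two slices are $E_n$ and $A$, and let $\mathrm{rank}_{\mathbb{K}}(E_n;A)$ be the least $r$ for which it is a sum of $r$ tensors of the form $a\otimes b\otimes c$ with $a,b\in\mathbb{K}^n$, $c\in\mathbb{K}^2$. Then $$\mathrm{rank}_{\mathbb{K}}(E_n;A)\ \ge\ n+k.$$ -/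

import Mathlib

open Polynomial

noncomputable section

/-- An `m × n × p` array over `K`, given by its `p` slices, each an `m × n` matrix. -/
abbrev Tensor3 (K : Type*) (m n p : ℕ) : Type _ := Fin p → Matrix (Fin m) (Fin n) K

/-- The rank-one array `a ⊗ b ⊗ c`, whose `(i, j, t)` entry is `a i * b j * c t`
(it is zero if one of the vectors is zero). -/
def Tensor3.pure {K : Type*} [Field K] {m n p : ℕ}
    (a : Fin m → K) (b : Fin n → K) (c : Fin p → K) : Tensor3 K m n p :=
  fun t => Matrix.of fun i j => a i * b j * c t

/-- `T` is a sum of `r` arrays of the form `a ⊗ b ⊗ c` with entries in `K`. -/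
def Tensor3.IsSumOfPure {K : Type*} [Field K] {m n p : ℕ} (T : Tensor3 K m n p) (r : ℕ) : Prop :=
  ∃ (a : Fin r → Fin m → K) (b : Fin r → Fin n → K) (c : Fin r → Fin p → K),
    T = ∑ l : Fin r, Tensor3.pure (a l) (b l) (c l)

/-- The rank of `T` over `K`: the least `r` such that `T` is a sum of `r` arrays `a ⊗ b ⊗ c`. -/
def Tensor3.rank {K : Type*} [Field K] {m n p : ℕ} (T : Tensor3 K m n p) : ℕ :=
  sInf {r : ℕ | T.IsSumOfPure r}

/-- The minimum defining the rank is taken over a nonempty set, so it is attained. -/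
theorem Tensor3.isSumOfPure_rank {K : Type*} [Field K] {m n p : ℕ} (T : Tensor3 K m n p) :
    T.IsSumOfPure T.rank := by
  refine Nat.sInf_mem (s := {r : ℕ | T.IsSumOfPure r})
    ⟨Fintype.card (Fin m × Fin n × Fin p), ?_⟩
  let e := (Fintype.equivFin (Fin m × Fin n × Fin p)).symm
  refine ⟨fun l => Pi.single (e l).1 (T (e l).2.2 (e l).1 (e l).2.1),
    fun l => Pi.single (e l).2.1 1, fun l => Pi.single (e l).2.2 1, ?_⟩
  have h := e.sum_comp (fun x : Fin m × Fin n × Fin p =>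
    Tensor3.pure (K := K) (Pi.single x.1 (T x.2.2 x.1 x.2.1)) (Pi.single x.2.1 1)
      (Pi.single x.2.2 1))
  rw [h]
  funext t
  ext i j
  simp [Tensor3.pure, Finset.sum_apply, Matrix.sum_apply, Fintype.sum_prod_type, Pi.single_apply]

/-- The tensor `(A; B)` with the two slices `A` and `B`. -/
def Tensor3.ofSlices {K : Type*} {m n : ℕ} (A B : Matrix (Fin m) (Fin n) K) : Tensor3 K m n 2 :=
  ![A, B]

open Classical in
/-- `d_i(M)`: the monic (or zero) greatest common divisor of all `i × i` minors of `M`. -/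
def minorGCD {K : Type*} [Field K] {m n : ℕ} (M : Matrix (Fin m) (Fin n) K[X]) (i : ℕ) : K[X] :=
  letI : NormalizedGCDMonoid K[X] := UniqueFactorizationMonoid.toNormalizedGCDMonoid K[X]
  letI : Fintype ((Fin i ↪o Fin m) × (Fin i ↪o Fin n)) := Fintype.ofFinite _
  Finset.univ.gcd fun s : (Fin i ↪o Fin m) × (Fin i ↪o Fin n) => (M.submatrix s.1 s.2).det

/-- `e_i(M) = d_i(M) / d_{i-1}(M)`, for `i ≥ 1`. -/
def elementaryDivisor {K : Type*} [Field K] {m n : ℕ} (M : Matrix (Fin m) (Fin n) K[X]) (i : ℕ) :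
    K[X] :=
  minorGCD M i / minorGCD M (i - 1)

/-- The `i`-th invariant polynomial `p_i(A) = e_{n-i+1}(x E_n - A)`, for `1 ≤ i ≤ n`. -/
def invariantPolynomial {K : Type*} [Field K] {n : ℕ} (A : Matrix (Fin n) (Fin n) K) (i : ℕ) :
    K[X] :=
  elementaryDivisor A.charmatrix (n - i + 1)

/-- `f` is a product of distinct linear factors over `K`, up to a nonzero constant
(the empty product is allowed, so nonzero constants qualify). -/
def IsProdDistinctLinear {K : Type*} [Field K] (f : K[X]) : Prop :=
  ∃ (c : K) (s : Finset K), c ≠ 0 ∧ f = C c * ∏ a ∈ s, (X - C a)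

open Classical in
/-- The number of `i ∈ {1, …, n}` such that `p_i(A)` is not a product of distinct linear
factors over `K`. -/
def numNonsplitInvariant {K : Type*} [Field K] {n : ℕ} (A : Matrix (Fin n) (Fin n) K) : ℕ :=
  ((Finset.Icc 1 n).filter fun i => ¬ IsProdDistinctLinear (invariantPolynomial A i)).card

end

/-!
A decomposition of `(1; A)` into `r` pure tensors gives factorizations `1 = P D₀ Q` and
`A = P D₁ Q` with diagonal `r × r` matrices `D₀`, `D₁`, hence `X - A = P L Q` with `L = X D₀ - D₁`
diagonal. After vanishing third vectors are removed, the entries of `L` are nonzero constants or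
linear polynomials, so they all divide some product `f` of distinct linear polynomials.

The first identity shows that `P` has a right inverse `S` and `Q` a left inverse `T`, and that
`n ≤ r`. With `L L' = f`, the splitting `1 = Q T + (1 - Q T)` yields
`f = P L L' S = (X - A) T L' S + P L (1 - Q T) L' S`, where the second summand has rank at most
`r - n`. In other words, multiplication by `f` on the cokernel of `X - A` has its image in the
submodule generated by the columns of a matrix of rank at most `r - n`. In Smith coordinates
`diag(a₀, …, aₙ₋₁)`, with `a₀ ∣ a₁ ∣ ⋯`, the block of rows and columns from `m` on reads
`f = aₘ W + Z`, where `Z` has rank at most `r - n`. If `n - m > r - n`, then `det (f - aₘ W) = 0`,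
so `f / aₘ` is an eigenvalue of `W`; it is integral over `K[X]`, that is, `aₘ ∣ f`
(`Matrix.smith_dvd_of_factorization`).

By the Smith normal form (`Matrix.exists_smith_normal_form`) and the invariance of common divisors
of minors under multiplication (`Matrix.dvd_minors_mul_left`), the polynomial `elementaryDivisor`
of index `m + 1` is `aₘ` up to a unit (`associated_elementaryDivisor`). Hence `p_i(A)` divides
`f`, and is therefore a product of distinct linear polynomials, for every `i > r - n`.
-/

/-! ### Smith normal form over a principal ideal domain -/

open Module in
theorem exists_eq_smul_of_forall_dual_dvd {R : Type*} [CommRing R]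
    {ι N : Type*} [Fintype ι] [AddCommGroup N] [Module R N]
    (b : Basis ι R N) (g : R) (y : N) (h : ∀ u : Dual R N, g ∣ u y) : ∃ w, y = g • w := by
  choose c hc using fun i => h (b.coord i)
  refine ⟨∑ i, c i • b i, ?_⟩
  rw [Finset.smul_sum]
  conv_lhs => rw [← b.sum_repr y]
  refine Finset.sum_congr rfl fun i _ => ?_
  rw [smul_smul, ← hc i, Basis.coord_apply]

open Module in
/-- Among the values `u (T v)` of a linear map `T` over a principal ideal domain, where `u` runs
over functionals and `v` over vectors, one divides all others: a generator of the content of `T`,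
which is thus an entry of the matrix of `T` in suitable bases. -/
theorem exists_dual_apply_dvd {R : Type*} [CommRing R] [IsDomain R] [IsPrincipalIdealRing R]
    {ι M N : Type*} [Fintype ι] [AddCommGroup M] [Module R M] [AddCommGroup N] [Module R N]
    (c : Basis ι R N) (T : M →ₗ[R] N) :
    ∃ (u : Dual R N) (v : M), ∀ (u' : Dual R N) (v' : M), u (T v) ∣ u' (T v') := by
  obtain ⟨I, ⟨u, v, rfl⟩, hI⟩ := set_has_maximal_iff_noetherian.2
    (inferInstance : IsNoetherian R R)
    {I : Ideal R | ∃ (u : Dual R N) (v : M), I = Ideal.span {u (T v)}} ⟨_, 0, 0, rfl⟩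
  have key : ∀ (u₁ : Dual R N) (v₁ : M), u₁ (T v₁) ∣ u (T v) → u (T v) ∣ u₁ (T v₁) := by
    intro u₁ v₁ h
    by_contra hn
    refine hI _ ⟨u₁, v₁, rfl⟩ (lt_of_le_of_ne (Ideal.span_singleton_le_span_singleton.2 h) ?_)
    intro he
    exact hn (Ideal.span_singleton_le_span_singleton.1 he.ge)
  -- the greatest common divisor of `u (T v)` and `z` is again a value `u₁ (T v₁)`, so by maximality
  -- it is associated to `u (T v)`
  have bezout : ∀ z, (∀ x y, ∃ (u₁ : Dual R N) (v₁ : M), u₁ (T v₁) = x * u (T v) + y * z) →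
      u (T v) ∣ z := by
    intro z hz
    obtain ⟨g, hg⟩ := IsPrincipalIdealRing.principal (Ideal.span {u (T v), z})
    have hdvd : ∀ w ∈ Ideal.span {u (T v), z}, g ∣ w := fun w hw =>
      Ideal.mem_span_singleton.1 (by rw [hg] at hw; exact hw)
    obtain ⟨x, y, hxy⟩ := Ideal.mem_span_pair.1
      (show g ∈ Ideal.span {u (T v), z} by rw [hg]; exact Submodule.mem_span_singleton_self g)
    obtain ⟨u₁, v₁, e⟩ := hz x y
    rw [hxy] at e
    have h := key u₁ v₁ (e ▸ hdvd _ (Ideal.subset_span (by simp)))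
    rw [e] at h
    exact h.trans (hdvd _ (Ideal.subset_span (by simp)))
  have right : ∀ (u₁ : Dual R N), u₁ (T v) = u (T v) → ∀ v', u (T v) ∣ u₁ (T v') :=
    fun u₁ h₁ v' => bezout _ fun x y => ⟨u₁, x • v + y • v', by simp [h₁]⟩
  have left : ∀ (u' : Dual R N), u (T v) ∣ u' (T v) :=
    fun u' => bezout _ fun x y => ⟨x • u + y • u', v, by simp⟩
  refine ⟨u, v, fun u' v' => ?_⟩
  by_cases hg : u (T v) = 0
  · exact key u' v' (hg ▸ dvd_zero _)
  obtain ⟨w, hw⟩ := exists_eq_smul_of_forall_dual_dvd c (u (T v)) (T v) left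
  have hu : u w = 1 := by
    refine mul_left_cancel₀ hg ?_
    rw [← smul_eq_mul, ← map_smul, ← hw, mul_one]
  -- `u + (u' - u' w • u)` takes the same value as `u` at `T v`, so `right` applies to it
  have h := right (u + (u' - u' w • u)) (by
    rw [LinearMap.add_apply, LinearMap.sub_apply, LinearMap.smul_apply]
    have : u' (T v) = u (T v) * u' w := by conv_lhs => rw [hw, map_smul, smul_eq_mul]
    rw [this, smul_eq_mul]; ring) v'
  rw [LinearMap.add_apply, LinearMap.sub_apply, LinearMap.smul_apply, smul_eq_mul] at h
  have h2 := right u rfl v'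
  have h3 := (dvd_add_right h2).1 h
  exact (dvd_sub_left (h2.mul_left _)).1 h3

open Module in
theorem exists_basis_ker {R : Type*} [CommRing R] [IsDomain R] [IsPrincipalIdealRing R]
    {n : ℕ} {M : Type*} [AddCommGroup M] [Module R M] (b : Basis (Fin (n + 1)) R M)
    (f : Dual R M) (v : M) (h : f v = 1) :
    Nonempty (Basis (Fin n) R (LinearMap.ker f)) := by
  have := Module.Free.of_basis b
  have := Module.Finite.of_basis b
  have h1 := Submodule.finrank_quotient_add_finrank (LinearMap.ker (f : M →ₗ[R] R))
  rw [(LinearMap.quotKerEquivOfSurjective (f : M →ₗ[R] R) fun x => ⟨x • v, by simp [h]⟩).finrank_eq,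
    finrank_self, finrank_eq_card_basis b, Fintype.card_fin] at h1
  exact ⟨finBasisOfFinrankEq R _ (by omega)⟩

open Module in
/-- Smith normal form of a linear map between free modules of equal finite rank. The divisibility
chain is automatic: `T` is divided by its content before the induction hypothesis is applied to a
map between complements of rank one less. -/
theorem exists_smith_bases {R : Type*} [CommRing R] [IsDomain R] [IsPrincipalIdealRing R]
    (n : ℕ) : ∀ {M N : Type*} [AddCommGroup M] [Module R M] [AddCommGroup N] [Module R N]
    (_ : Basis (Fin n) R M) (_ : Basis (Fin n) R N) (T : M →ₗ[R] N),
    ∃ (b : Basis (Fin n) R M) (c : Basis (Fin n) R N) (a : Fin n → R),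
      (∀ i, T (b i) = a i • c i) ∧ ∀ i j, i ≤ j → a i ∣ a j := by
  induction n with
  | zero => exact fun b c T => ⟨b, c, 0, fun i => i.elim0, fun i => i.elim0⟩
  | succ n ih =>
    intro M N _ _ _ _ b c T
    obtain ⟨u, v, huv⟩ := exists_dual_apply_dvd c T
    choose d hd using fun i => exists_eq_smul_of_forall_dual_dvd c (u (T v)) (T (b i))
      fun u' => huv u' (b i)
    by_cases hg : u (T v) = 0
    · refine ⟨b, c, 0, fun i => ?_, fun _ _ _ => dvd_rfl⟩
      rw [hd i, hg, Pi.zero_apply, zero_smul, zero_smul]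
    set T' : M →ₗ[R] N := b.constr R d with hT'
    have hT : T = u (T v) • T' := b.ext fun i => by
      rw [LinearMap.smul_apply, hT', b.constr_basis, ← hd i]
    have h1 : u (T' v) = 1 := by
      refine mul_left_cancel₀ hg ?_
      conv_rhs => rw [mul_one, hT]
      simp
    obtain ⟨b₀⟩ := exists_basis_ker b (u ∘ₗ T') v h1
    obtain ⟨c₀⟩ := exists_basis_ker c u (T' v) h1
    -- the complement `ker (u ∘ T')` of `v` is mapped into the complement `ker u` of `T' v`
    obtain ⟨b₁, c₁, a, hba, ha⟩ := ih b₀ c₀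
      (T'.restrict (p := LinearMap.ker (u ∘ₗ T')) (q := LinearMap.ker u) fun x hx => hx)
    refine ⟨Basis.mkFinCons v b₁ ?_ ?_, Basis.mkFinCons (T' v) c₁ ?_ ?_,
      Fin.cons (u (T v)) (u (T v) • a), ?_, ?_⟩
    · intro r x hx h
      have := congrArg (u ∘ₗ T') h
      rw [map_add, LinearMap.mem_ker.1 hx] at this
      simpa [h1] using this
    · intro z
      exact ⟨-u (T' z), by simp [h1]⟩
    · intro r x hx h
      have := congrArg u h
      rw [map_add, LinearMap.mem_ker.1 hx] at this
      simpa [h1] using this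
    · intro z
      exact ⟨-u z, by simp [h1]⟩
    · intro i
      rw [Basis.coe_mkFinCons, Basis.coe_mkFinCons]
      refine Fin.cases ?_ (fun i => ?_) i
      · rw [Fin.cons_zero, Fin.cons_zero, Fin.cons_zero]
        exact LinearMap.congr_fun hT v
      · have := congrArg Subtype.val (hba i)
        simp only [Fin.cons_succ, Function.comp_apply, Pi.smul_apply, smul_eq_mul, mul_smul]
        rw [← Submodule.coe_smul, ← this]
        exact LinearMap.congr_fun hT (b₁ i)
    · intro i j
      refine Fin.cases ?_ (fun i => ?_) i <;> refine Fin.cases ?_ (fun j => ?_) j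
      · simp
      · simp
      · simp
      · intro h
        simpa using mul_dvd_mul_left _ (ha i j (Fin.succ_le_succ_iff.1 h))

open Module in
/-- Smith normal form of a square matrix over a principal ideal domain. The invertible
transformations are given together with their inverses `U'` and `V'`. -/
theorem Matrix.exists_smith_normal_form {R : Type*} [CommRing R] [IsDomain R]
    [IsPrincipalIdealRing R] {n : ℕ} (M : Matrix (Fin n) (Fin n) R) :
    ∃ (U U' V V' : Matrix (Fin n) (Fin n) R) (a : Fin n → R), U * U' = 1 ∧ U' * U = 1 ∧
      V * V' = 1 ∧ V' * V = 1 ∧ U * M * V = Matrix.diagonal a ∧ ∀ i j, i ≤ j → a i ∣ a j := by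
  let e := Pi.basisFun R (Fin n)
  obtain ⟨b, c, a, h, ha⟩ := exists_smith_bases n e e (Matrix.toLin e e M)
  refine ⟨c.toMatrix e, e.toMatrix c, e.toMatrix b, b.toMatrix e, a,
    Basis.toMatrix_mul_toMatrix_flip _ _, Basis.toMatrix_mul_toMatrix_flip _ _,
    Basis.toMatrix_mul_toMatrix_flip _ _, Basis.toMatrix_mul_toMatrix_flip _ _, ?_, ha⟩
  have := basis_toMatrix_mul_linearMap_toMatrix_mul_basis_toMatrix b e c e (Matrix.toLin e e M)
  rw [LinearMap.toMatrix_toLin] at this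
  rw [this]
  ext i j
  rw [LinearMap.toMatrix_apply, h, map_smul, Basis.repr_self, Matrix.diagonal_apply]
  by_cases hij : i = j
  · subst hij; simp
  · simp [hij]

/-! ### Minors of products and of diagonal matrices -/

/-- A common divisor of the maximal minors with increasing rows divides those with arbitrary,
possibly repeated, rows. -/
theorem Matrix.dvd_det_submatrix_of_orderEmb {R : Type*} [CommRing R] {m i : ℕ}
    (N : Matrix (Fin m) (Fin i) R) (g : R)
    (h : ∀ s : Fin i ↪o Fin m, g ∣ (N.submatrix s id).det) (s : Fin i → Fin m) :
    g ∣ (N.submatrix s id).det := by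
  by_cases hs : Function.Injective s
  · have hm : StrictMono (s ∘ Tuple.sort s) :=
      (Tuple.monotone_sort s).strictMono_of_injective (hs.comp (Equiv.injective _))
    have h1 := h (OrderEmbedding.ofStrictMono _ hm)
    have h2 : N.submatrix (OrderEmbedding.ofStrictMono _ hm) id =
        (N.submatrix s id).submatrix (Tuple.sort s) id := rfl
    rw [h2, Matrix.det_permute] at h1
    exact (Units.isUnit _).map (Int.castRingHom R) |>.dvd_mul_left.1 h1
  · obtain ⟨x, y, hxy, hne⟩ := Function.not_injective_iff.1 hs
    rw [Matrix.det_zero_of_row_eq hne (by ext; simp [hxy])]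
    exact dvd_zero g

/-- The divisibility part of the Cauchy–Binet formula: every minor of `U * M` is a linear
combination of minors of `M` of the same size. -/
theorem Matrix.dvd_minors_mul_left {R : Type*} [CommRing R] {m n p i : ℕ}
    (U : Matrix (Fin p) (Fin m) R) (M : Matrix (Fin m) (Fin n) R) (g : R)
    (h : ∀ (s : Fin i ↪o Fin m) (t : Fin i ↪o Fin n), g ∣ (M.submatrix s t).det)
    (s : Fin i ↪o Fin p) (t : Fin i ↪o Fin n) : g ∣ ((U * M).submatrix s t).det := by
  have e : (U * M).submatrix s t = fun k => ∑ l, U (s k) l • fun j => M l (t j) := by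
    ext k j
    simp [Matrix.mul_apply]
  rw [e]
  change g ∣ Matrix.detRowAlternating.toMultilinearMap _
  rw [MultilinearMap.map_sum]
  refine Finset.dvd_sum fun r _ => ?_
  rw [MultilinearMap.map_smul_univ]
  refine dvd_mul_of_dvd_right ?_ _
  exact Matrix.dvd_det_submatrix_of_orderEmb (M.submatrix id t) g (fun s' => h s' t) r

theorem Matrix.dvd_minors_mul_right {R : Type*} [CommRing R] {m n p i : ℕ}
    (M : Matrix (Fin m) (Fin n) R) (V : Matrix (Fin n) (Fin p) R) (g : R)
    (h : ∀ (s : Fin i ↪o Fin m) (t : Fin i ↪o Fin n), g ∣ (M.submatrix s t).det)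
    (s : Fin i ↪o Fin m) (t : Fin i ↪o Fin p) : g ∣ ((M * V).submatrix s t).det := by
  rw [← Matrix.det_transpose, Matrix.transpose_submatrix, Matrix.transpose_mul]
  refine Matrix.dvd_minors_mul_left _ _ g (fun s t => ?_) t s
  rw [← Matrix.transpose_submatrix, Matrix.det_transpose]
  exact h t s

/-- In a diagonal matrix with a divisibility chain, the leading principal minor divides all minors
of its size, as the `k`-th element of a set of row indices is at least `k`. -/
theorem Matrix.dvd_minors_diagonal {R : Type*} [CommRing R] {n i : ℕ} (hi : i ≤ n)
    (a : Fin n → R) (ha : ∀ i j, i ≤ j → a i ∣ a j) (s t : Fin i ↪o Fin n) :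
    ∏ k : Fin i, a (Fin.castLE hi k) ∣ ((Matrix.diagonal a).submatrix s t).det := by
  have e : (Matrix.diagonal a).submatrix s t =
      Matrix.diagonal (a ∘ s) * (1 : Matrix (Fin n) (Fin n) R).submatrix s t := by
    ext k l
    simp [Matrix.diagonal_mul, Matrix.diagonal_apply, Matrix.one_apply]
  rw [e, Matrix.det_mul, Matrix.det_diagonal]
  refine dvd_mul_of_dvd_left (Finset.prod_dvd_prod_of_dvd _ _ fun k _ => ha _ _ ?_) _
  have hs : ∀ (x : ℕ) (hx : x < i), x ≤ s ⟨x, hx⟩ := by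
    intro x
    induction x with
    | zero => exact fun _ => Nat.zero_le _
    | succ x ih =>
      intro hx
      have h1 : s ⟨x, by omega⟩ < s ⟨x + 1, hx⟩ := s.strictMono (Fin.mk_lt_mk.2 x.lt_succ_self)
      exact (ih (by omega)).trans_lt h1
  exact hs k k.2

/-! ### Invariant factors of a matrix factored through a diagonal one -/

/-- If `T * Q = 1`, then `1 - Q * T` is the projection of an `r`-dimensional space along the
`n`-dimensional range of `Q`. It has rank at most `r - n`, so larger minors of its multiples
vanish. -/
theorem Matrix.det_mul_one_sub_mul_eq_zero {R : Type*} [CommRing R] [IsDomain R]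
    {ι : Type*} [Fintype ι] [DecidableEq ι] {n r : ℕ}
    (Q : Matrix (Fin r) (Fin n) R) (T : Matrix (Fin n) (Fin r) R) (hTQ : T * Q = 1)
    (X : Matrix ι (Fin r) R) (Y : Matrix (Fin r) ι R) (hr : r < n + Fintype.card ι) :
    (X * (1 - Q * T) * Y).det = 0 := by
  have hz : (1 - Q * T) * Q = 0 := by
    rw [Matrix.sub_mul, Matrix.one_mul, Matrix.mul_assoc, hTQ, Matrix.mul_one, sub_self]
  let φ := algebraMap R (FractionRing R)
  have h1 : (X * (1 - Q * T) * Y).map φ = X.map φ * (1 - Q * T).map φ * Y.map φ := by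
    rw [Matrix.map_mul, Matrix.map_mul]
  have h2 := Matrix.rank_add_rank_le_card_of_mul_eq_zero
    (A := (1 - Q * T).map φ) (B := Q.map φ) (by rw [← Matrix.map_mul, hz]; simp)
  have h3 : n ≤ (Q.map φ).rank := by
    have h := Matrix.rank_mul_le_right (T.map φ) (Q.map φ)
    rw [← Matrix.map_mul, hTQ, Matrix.map_one _ (map_zero _) (map_one _), Matrix.rank_one,
      Fintype.card_fin] at h
    exact h
  rw [Fintype.card_fin] at h2
  by_contra hne
  have h4 : ((X * (1 - Q * T) * Y).map φ).det ≠ 0 := by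
    rw [← RingHom.mapMatrix_apply, ← RingHom.map_det]
    exact fun h => hne (FaithfulSMul.algebraMap_injective R (FractionRing R)
      (h.trans (map_zero φ).symm))
  have h5 := Matrix.rank_of_det_ne_zero h4
  rw [h1] at h5
  have h6 := (Matrix.rank_mul_le_left (X.map φ * (1 - Q * T).map φ) (Y.map φ)).trans
    (Matrix.rank_mul_le_right _ _)
  omega

/-- If `f • 1 - a • W` is singular, then the fraction `f / a` is an eigenvalue of `W`, hence
integral. -/
theorem Matrix.dvd_of_det_smul_one_sub_smul_eq_zero {R : Type*} [CommRing R] [IsDomain R]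
    [IsIntegrallyClosed R] {ι : Type*} [Fintype ι] [DecidableEq ι]
    (W : Matrix ι ι R) {f a : R} (ha : a ≠ 0)
    (h : (f • (1 : Matrix ι ι R) - a • W).det = 0) : a ∣ f := by
  let φ := algebraMap R (FractionRing R)
  have hφ : Function.Injective φ := FaithfulSMul.algebraMap_injective R (FractionRing R)
  have ha' : φ a ≠ 0 := fun h0 => ha (hφ (by simpa using h0))
  have hroot : (W.map φ).charpoly.eval (φ f / φ a) = 0 := by
    rw [Matrix.eval_charpoly]
    have h1 := congrArg φ h
    rw [RingHom.map_det, map_zero] at h1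
    have h2 : φ.mapMatrix (f • (1 : Matrix ι ι R) - a • W) =
        φ a • (Matrix.scalar ι (φ f / φ a) - W.map φ) := by
      ext i j
      by_cases hij : i = j
      · subst hij
        simp [mul_sub, mul_div_cancel₀ _ ha']
      · simp [hij]
    rw [h2, Matrix.det_smul] at h1
    exact (mul_eq_zero.1 h1).resolve_left (pow_ne_zero _ ha')
  have hint : IsIntegral R (φ f / φ a) := by
    refine ⟨W.charpoly, W.charpoly_monic, ?_⟩
    rw [Matrix.charpoly_map] at hroot
    rwa [eval_map] at hroot
  obtain ⟨y, hy⟩ := IsIntegrallyClosed.isIntegral_iff.1 hint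
  refine ⟨y, hφ ?_⟩
  rw [map_mul]
  change φ f = φ a * algebraMap R (FractionRing R) y
  rw [hy, mul_div_cancel₀ _ ha']

/-- Let `M = P L Q` be a factorization through `r` dimensions, with `P` right invertible, `Q` left
invertible and `L` diagonal with entries dividing `f`. Then the first `2 * n - r` invariant
factors of `M` divide `f`: all but `r - n` of them. -/
theorem Matrix.smith_dvd_of_factorization {R : Type*} [CommRing R] [IsDomain R]
    [IsIntegrallyClosed R] {n r : ℕ}
    {M U U' V V' : Matrix (Fin n) (Fin n) R} {a : Fin n → R} (hU : U * U' = 1)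
    (hV : V * V' = 1) (hD : U * M * V = Matrix.diagonal a)
    (ha : ∀ i j, i ≤ j → a i ∣ a j) (P : Matrix (Fin n) (Fin r) R) (Q : Matrix (Fin r) (Fin n) R)
    (S : Matrix (Fin r) (Fin n) R) (T : Matrix (Fin n) (Fin r) R) (hP : P * S = 1)
    (hQ : T * Q = 1) (l l' : Fin r → R) (f : R) (hl : ∀ x, l x * l' x = f)
    (hM : M = P * Matrix.diagonal l * Q) (m : Fin n) (hm : a m ≠ 0) (hr : r + m < n + n) :
    a m ∣ f := by
  obtain ⟨N, hN⟩ : ∃ N, N = 1 - Q * T := ⟨_, rfl⟩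
  -- multiplication by `f` equals a multiple of `M` up to a matrix of rank at most `r - n`
  have hf : f • (1 : Matrix (Fin n) (Fin n) R) =
      M * (T * Matrix.diagonal l' * S) +
        P * Matrix.diagonal l * N * (Matrix.diagonal l' * S) := by
    have h1 : Matrix.diagonal l * Matrix.diagonal l' = f • (1 : Matrix (Fin r) (Fin r) R) := by
      rw [Matrix.diagonal_mul_diagonal, Matrix.smul_one_eq_diagonal]
      exact congrArg _ (funext hl)
    calc f • (1 : Matrix (Fin n) (Fin n) R)
        = P * (f • (1 : Matrix (Fin r) (Fin r) R)) * S := by simp [hP]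
      _ = P * (Matrix.diagonal l * (Q * T + N) * Matrix.diagonal l') * S := by
          rw [hN, add_sub_cancel, Matrix.mul_one, h1]
      _ = _ := by rw [hM]; simp only [Matrix.mul_add, Matrix.add_mul, Matrix.mul_assoc]
  have hD' : U * M = Matrix.diagonal a * V' := by
    rw [← hD, Matrix.mul_assoc, hV, Matrix.mul_one]
  set Y := V' * (T * Matrix.diagonal l' * S) * U' with hY
  set X₁ := U * P * Matrix.diagonal l with hX₁
  set Y₁ := Matrix.diagonal l' * S * U' with hY₁
  have hf' : f • (1 : Matrix (Fin n) (Fin n) R) =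
      Matrix.diagonal a * Y + X₁ * N * Y₁ := by
    calc f • (1 : Matrix (Fin n) (Fin n) R) = U * (f • (1 : Matrix (Fin n) (Fin n) R)) * U' := by
          simp [hU]
      _ = (U * M) * (T * Matrix.diagonal l' * S) * U' + X₁ * N * Y₁ := by
          rw [hf]; simp only [Matrix.mul_add, Matrix.add_mul, Matrix.mul_assoc, hX₁, hY₁]
      _ = _ := by rw [hD']; simp only [Matrix.mul_assoc, hY]
  -- on the rows and columns from `m` on, `diagonal a * Y` is divisible by `a m`, whereas the other
  -- summand has rank at most `r - n`, less than the size `n - m` of the block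
  let J := {j : Fin n // m ≤ j}
  choose c hc using fun j : J => ha m j j.2
  have hcard : Fintype.card J = n - m := by
    rw [Fintype.card_subtype, ← Fin.card_Ici]
    congr 1
    ext
    simp
  refine Matrix.dvd_of_det_smul_one_sub_smul_eq_zero
    (Matrix.of fun i j : J => c i * Y i j) hm ?_
  have hsub : f • (1 : Matrix J J R) - a m • Matrix.of (fun i j : J => c i * Y i j) =
      X₁.submatrix (Subtype.val : J → Fin n) id * N *
        Y₁.submatrix id (Subtype.val : J → Fin n) := by
    ext i j
    have h := congrFun (congrFun hf' i) j
    rw [Matrix.add_apply, Matrix.diagonal_mul, hc i] at h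
    have h1 : (1 : Matrix J J R) i j = (1 : Matrix (Fin n) (Fin n) R) i j := by
      simp only [Matrix.one_apply, Subtype.val_inj, J]
    have h2 : (X₁.submatrix (Subtype.val : J → Fin n) id * N *
        Y₁.submatrix id (Subtype.val : J → Fin n)) i j = (X₁ * N * Y₁) i j := by
      simp [Matrix.mul_apply]
    rw [h2, Matrix.sub_apply, Matrix.smul_apply, Matrix.smul_apply, h1, ← Matrix.smul_apply f, h,
      Matrix.of_apply, smul_eq_mul]
    ring
  rw [hsub, hN]
  exact Matrix.det_mul_one_sub_mul_eq_zero Q T hQ _ _ (by omega)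

/-! ### Determinantal divisors of polynomial matrices -/

theorem minorGCD_dvd {K : Type*} [Field K] {m n i : ℕ} (M : Matrix (Fin m) (Fin n) K[X])
    (s : Fin i ↪o Fin m) (t : Fin i ↪o Fin n) : minorGCD M i ∣ (M.submatrix s t).det := by
  classical
  let : NormalizedGCDMonoid K[X] := UniqueFactorizationMonoid.toNormalizedGCDMonoid K[X]
  let : Fintype ((Fin i ↪o Fin m) × (Fin i ↪o Fin n)) := Fintype.ofFinite _
  exact Finset.gcd_dvd (f := fun s : (Fin i ↪o Fin m) × (Fin i ↪o Fin n) =>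
    (M.submatrix s.1 s.2).det) (Finset.mem_univ (s, t))

theorem dvd_minorGCD {K : Type*} [Field K] {m n i : ℕ} {M : Matrix (Fin m) (Fin n) K[X]}
    {g : K[X]} (h : ∀ (s : Fin i ↪o Fin m) (t : Fin i ↪o Fin n), g ∣ (M.submatrix s t).det) :
    g ∣ minorGCD M i := by
  classical
  let : NormalizedGCDMonoid K[X] := UniqueFactorizationMonoid.toNormalizedGCDMonoid K[X]
  exact Finset.dvd_gcd fun s _ => h s.1 s.2

/-- The `i`-th determinantal divisor is the product of the first `i` diagonal entries of the Smith
normal form. -/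
theorem associated_minorGCD {K : Type*} [Field K] {n : ℕ}
    {M U U' V V' : Matrix (Fin n) (Fin n) K[X]} {a : Fin n → K[X]} (hU : U' * U = 1)
    (hV : V * V' = 1) (hD : U * M * V = Matrix.diagonal a)
    (ha : ∀ i j, i ≤ j → a i ∣ a j) {i : ℕ} (hi : i ≤ n) :
    Associated (minorGCD M i) (∏ k : Fin i, a (Fin.castLE hi k)) := by
  have hM : M = U' * Matrix.diagonal a * V' := by
    rw [← hD, ← Matrix.mul_assoc, ← Matrix.mul_assoc, hU, Matrix.one_mul, Matrix.mul_assoc, hV,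
      Matrix.mul_one]
  refine associated_of_dvd_dvd ?_ ?_
  · have h1 := Matrix.dvd_minors_mul_right _ V _ (Matrix.dvd_minors_mul_left U M _
      (minorGCD_dvd M)) (Fin.castLEOrderEmb hi) (Fin.castLEOrderEmb hi)
    rw [hD, Matrix.submatrix_diagonal _ _ (Fin.castLEOrderEmb hi).injective,
      Matrix.det_diagonal] at h1
    exact h1
  · rw [hM]
    exact dvd_minorGCD (Matrix.dvd_minors_mul_right _ V' _ (Matrix.dvd_minors_mul_left U' _ _
      (Matrix.dvd_minors_diagonal hi a ha)))

/-- The quotients of consecutive determinantal divisors are the diagonal entries of the Smith normal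
form; `elementaryDivisor` counts from `1`, the diagonal from `0`. -/
theorem associated_elementaryDivisor {K : Type*} [Field K] {n : ℕ}
    {M U U' V V' : Matrix (Fin n) (Fin n) K[X]} {a : Fin n → K[X]} (hU : U' * U = 1)
    (hV : V * V' = 1) (hD : U * M * V = Matrix.diagonal a)
    (ha : ∀ i j, i ≤ j → a i ∣ a j) (h0 : ∀ i, a i ≠ 0) (m : Fin n) :
    Associated (elementaryDivisor M (m + 1)) (a m) := by
  have h1 := associated_minorGCD hU hV hD ha (i := m + 1) m.2
  have h2 := associated_minorGCD hU hV hD ha (i := m) m.2.le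
  obtain ⟨u, hu⟩ := h1.symm
  obtain ⟨v, hv⟩ := h2
  have hne : minorGCD M m ≠ 0 := by
    intro h
    rw [h, zero_mul] at hv
    exact Finset.prod_ne_zero_iff.2 (fun k _ => h0 _) hv.symm
  rw [Fin.prod_univ_castSucc] at hu
  unfold elementaryDivisor
  rw [Nat.add_sub_cancel]
  have h3 : minorGCD M (m + 1) = minorGCD M m * (a m * (v * u : K[X]ˣ)) := by
    rw [← hu]
    change (∏ k : Fin m, a (Fin.castLE m.2.le k)) * a m * u = _
    rw [← hv, Units.val_mul]
    ring
  rw [h3, mul_div_cancel_left₀ _ hne]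
  exact associated_mul_unit_left _ _ (Units.isUnit _)

/-! ### Tensor decompositions -/

/-- The third vectors of a decomposition can be taken nonzero: a vanishing summand can be rewritten
with its first vector equal to zero. -/
theorem Tensor3.IsSumOfPure.exists_forall_ne_zero {K : Type*} [Field K] {m n p r : ℕ} [NeZero p]
    {T : Tensor3 K m n p} (h : T.IsSumOfPure r) :
    ∃ (a : Fin r → Fin m → K) (b : Fin r → Fin n → K) (c : Fin r → Fin p → K),
      (∀ l, c l ≠ 0) ∧ T = ∑ l : Fin r, Tensor3.pure (a l) (b l) (c l) := by
  classical
  obtain ⟨a, b, c, rfl⟩ := h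
  refine ⟨fun l => if c l = 0 then 0 else a l, b, fun l => if c l = 0 then 1 else c l, ?_, ?_⟩
  · intro l
    dsimp only
    split_ifs with h
    · exact one_ne_zero
    · exact h
  · refine Finset.sum_congr rfl fun l _ => ?_
    ext t i j
    by_cases h : c l = 0 <;> simp [Tensor3.pure, h]

/-- A divisor of a squarefree split polynomial is squarefree and split. -/
theorem IsProdDistinctLinear.of_dvd {K : Type*} [Field K] {f g : K[X]}
    (hg : IsProdDistinctLinear g) (h : f ∣ g) : IsProdDistinctLinear f := by
  classical
  obtain ⟨c, s, hc, rfl⟩ := hg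
  have hs : ∏ a ∈ s, (X - C a) ≠ 0 := (monic_prod_X_sub_C _ s).ne_zero
  have hd : f ∣ ∏ a ∈ s, (X - C a) := (isUnit_C.2 hc.isUnit).dvd_mul_left.1 h
  have hsp : f.Splits := Splits.of_dvd (Splits.prod fun a _ => Splits.X_sub_C a) hs hd
  have hr : f.roots ≤ s.val := by
    rw [← roots_prod_X_sub_C s]
    exact roots.le_of_dvd hs hd
  have hf0 : f ≠ 0 := ne_zero_of_dvd_ne_zero hs hd
  refine ⟨f.leadingCoeff, ⟨f.roots, Multiset.nodup_of_le hr s.nodup⟩,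
    leadingCoeff_ne_zero.2 hf0, ?_⟩
  exact hsp.eq_prod_roots

/-- Nonzero linear forms evaluated at `(X, -1)` have a squarefree split common multiple: the product
over the set of their roots. The forms `(0, v)` give nonzero constants. -/
theorem exists_isProdDistinctLinear_forall_dvd {K : Type*} [Field K] {ι : Type*} [Fintype ι]
    (u v : ι → K) (h : ∀ l, u l ≠ 0 ∨ v l ≠ 0) :
    ∃ f : K[X], IsProdDistinctLinear f ∧ ∀ l, C (u l) * X - C (v l) ∣ f := by
  classical
  refine ⟨∏ a ∈ Finset.univ.image fun l => v l / u l, (X - C a),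
    ⟨1, _, one_ne_zero, by rw [C_1, one_mul]⟩, fun l => ?_⟩
  by_cases hu : u l = 0
  · refine IsUnit.dvd ?_
    have hv := (h l).resolve_left (not_not.2 hu)
    rw [hu, C_0, zero_mul, zero_sub]
    exact (isUnit_C.2 hv.isUnit).neg
  · have e : C (u l) * X - C (v l) = C (u l) * (X - C (v l / u l)) := by
      rw [mul_sub, ← C_mul, mul_div_cancel₀ _ hu]
    rw [e, (isUnit_C.2 (Ne.isUnit hu)).mul_left_dvd]
    exact Finset.dvd_prod_of_mem (fun a => X - C a)
      (Finset.mem_image_of_mem _ (Finset.mem_univ l))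

theorem Tensor3.sum_pure_apply {K : Type*} [Field K] {m n p r : ℕ} (a : Fin r → Fin m → K)
    (b : Fin r → Fin n → K) (c : Fin r → Fin p → K) (t : Fin p) :
    (∑ l, Tensor3.pure (a l) (b l) (c l)) t =
      (Matrix.of a).transpose * Matrix.diagonal (fun l => c l t) * Matrix.of b := by
  ext i j
  rw [Finset.sum_apply, Matrix.sum_apply, Matrix.mul_apply]
  refine Finset.sum_congr rfl fun l _ => ?_
  simp [Tensor3.pure, Matrix.mul_diagonal]
  ring

theorem mainTheorem3 {K : Type*} [Field K] (n : ℕ) (A : Matrix (Fin n) (Fin n) K) :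
    n + numNonsplitInvariant A ≤ (Tensor3.ofSlices (1 : Matrix (Fin n) (Fin n) K) A).rank := by
  classical
  obtain ⟨a, b, c, hc, hT⟩ := (Tensor3.isSumOfPure_rank
    (Tensor3.ofSlices (1 : Matrix (Fin n) (Fin n) K) A)).exists_forall_ne_zero
  generalize hr : (Tensor3.ofSlices (1 : Matrix (Fin n) (Fin n) K) A).rank = r at *
  set P := (Matrix.of a).transpose
  set Q := Matrix.of b
  set D₀ := Matrix.diagonal fun l => c l 0
  set D₁ := Matrix.diagonal fun l => c l 1
  have h0 : (1 : Matrix (Fin n) (Fin n) K) = P * D₀ * Q :=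
    (congrFun hT 0).trans (Tensor3.sum_pure_apply a b c 0)
  have h1 : A = P * D₁ * Q := (congrFun hT 1).trans (Tensor3.sum_pure_apply a b c 1)
  have hnr : n ≤ r := by
    have h := Matrix.rank_mul_le_right (P * D₀) Q
    rw [← h0, Matrix.rank_one, Fintype.card_fin] at h
    exact h.trans ((Matrix.rank_le_card_height Q).trans_eq (Fintype.card_fin r))
  obtain ⟨f, hf, hdvd⟩ := exists_isProdDistinctLinear_forall_dvd (fun l => c l 0)
    (fun l => c l 1) fun l => by
      by_contra! h
      refine hc l (funext fun t => ?_)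
      fin_cases t
      exacts [h.1, h.2]
  choose l' hl' using hdvd
  obtain ⟨U, U', V, V', d, hU, hU', hV, -, hD, hd⟩ :=
    Matrix.exists_smith_normal_form A.charmatrix
  -- the determinant of `X - A` is monic, so no diagonal entry vanishes
  have hd0 : ∀ i, d i ≠ 0 := by
    have hdet : (U * A.charmatrix * V).det ≠ 0 := by
      have hu : U.det ≠ 0 := Matrix.det_ne_zero_of_right_inverse hU
      have hv : V.det ≠ 0 := Matrix.det_ne_zero_of_right_inverse hV
      rw [Matrix.det_mul, Matrix.det_mul]
      exact mul_ne_zero (mul_ne_zero hu A.charpoly_monic.ne_zero) hv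
    rw [hD, Matrix.det_diagonal] at hdet
    exact fun i => Finset.prod_ne_zero_iff.1 hdet i (Finset.mem_univ i)
  have hone : P.map C * (D₀.map C * Q.map C) = 1 := by
    rw [← Matrix.map_mul, ← Matrix.map_mul, ← Matrix.mul_assoc, ← h0,
      Matrix.map_one _ C_0 C_1]
  have hM : A.charmatrix =
      P.map C * Matrix.diagonal (fun l => C (c l 0) * X - C (c l 1)) * Q.map C := by
    have e : Matrix.diagonal (fun l => C (c l 0) * X - C (c l 1)) =
        (X : K[X]) • D₀.map C - D₁.map C := by
      ext1 i j
      by_cases hij : i = j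
      · subst hij
        simp [D₀, D₁, X_mul_C]
      · simp [D₀, D₁, hij]
    rw [e, Matrix.mul_sub, Matrix.sub_mul, Matrix.mul_smul, Matrix.smul_mul, Matrix.mul_assoc,
      hone, ← Matrix.map_mul, ← Matrix.map_mul, ← h1, Matrix.charmatrix,
      Matrix.smul_one_eq_diagonal]
    rfl
  have hgood : ∀ i, r - n < i → i ≤ n → IsProdDistinctLinear (invariantPolynomial A i) := by
    intro i hi hin
    have hlt : n - i < n := by omega
    refine hf.of_dvd ((associated_elementaryDivisor hU' hV hD hd hd0 ⟨n - i, hlt⟩).dvd.trans ?_)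
    exact Matrix.smith_dvd_of_factorization hU hV hD hd (P.map C) (Q.map C)
      (D₀.map C * Q.map C) (P.map C * D₀.map C) hone (by rw [Matrix.mul_assoc, hone]) _ l' f
      (fun l => (hl' l).symm) hM _ (hd0 _) (by simp only; omega)
  have hsub : ((Finset.Icc 1 n).filter fun i => ¬ IsProdDistinctLinear (invariantPolynomial A i)) ⊆
      Finset.Icc 1 (r - n) := by
    intro i hi
    rw [Finset.mem_filter, Finset.mem_Icc] at hi
    rw [Finset.mem_Icc]
    refine ⟨hi.1.1, ?_⟩
    by_contra! h
    exact hi.2 (hgood i h hi.1.2)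
  have hcard := Finset.card_le_card hsub
  rw [Nat.card_Icc, Nat.add_sub_cancel] at hcard
  have : numNonsplitInvariant A ≤ r - n := by
    unfold numNonsplitInvariant
    convert hcard
  omega
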